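/- **Setting.** Let $A,D\in\mathbb C^{n\times n}$, $\lambda_0\in\mathbb C$, and let $k\ge1$, $s_1,\dots,s_{k-1}\ge 0$, $s_k>0$ be integers. Let $[\Xi\ \ \Xi_c]\in\mathbb C^{n\times n}$ be invertible, $[\Sigma\ \ \Sigma_c]=[\Xi\ \ \Xi_c]^{-*}$, and $$A[\Xi\ \ \Xi_c]=[\Xi\ \ \Xi_c]\begin{bmatrix}\lambda_0I+N&0\\0&A_{22}\end{bmatrix},\qquad N=\operatorname{diag}(N_1,\dots,N_k),\qquad \lambda_0\notin\Lambda(A_{22}),$$ where $N_j$ is the $j\times j$ block matrix with blocks $I_{s_j}$ on the first block superdiagonal and zero blocks elsewhere (void if $s_j=0$). Partition $\Xi=[\Xi_1,\dots,\Xi_k]$, $\Xi_j=[\Xi_{j1},\dots,\Xi_{jj}]$, $\Sigma=[\Sigma_1,\dots,\Sigma_k]$, $\Sigma_j=[\Sigma_{j1},\dots,\Sigma_{jj}]$ accordingly, each $\Xi_{j\ell},\Sigma_{j\ell}$ having $s_j$ columns. Put, for $1\le i\le k$, $$\tilde\Xi_i=[\Xi_{i1},\Xi_{i+1,1},\dots,\Xi_{k1}],\qquad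 \tilde\Sigma_i=[\Sigma_{ii},\Sigma_{i+1,i+1},\dots,\Sigma_{kk}],\qquad W_i=\tilde\Sigma_i^*D\,\tilde\Xi_i .$$ Fix $\rho\in\{1,\dots,k\}$ and assume that $W_1,\dots,W_\rho$ are invertible and, if $\rho<k$, that $W_{\rho+1}$ is invertible. Set $$G_\rho^{(\rho)}=-W_{\rho+1}^{-1}\,\tilde\Sigma_{\rho+1}^*D\,\Xi_{\rho1},\qquad S_\rho=\Sigma_{\rho\rho}^*D\,\Xi_{\rho1}+\Sigma_{\rho\rho}^*D\,\tilde\Xi_{\rho+1}G_\rho^{(\rho)},$$ where for $\rho=k$ the matrix $G_\rho^{(\rho)}$ is void and $S_k=\Sigma_{kk}^*D\,\Xi_{k1}$. **Claim.** Let $\gamma^{(\rho)}$ be a simple eigenvalue of $S_\rho$ (algebraic multiplicity one), let $S_\rho\varphi=\gamma^{(\rho)}\varphi$ with $\varphi\ne0$, and let $\mu^{(\rho)}\in\mathbb C$ satisfy $(\mu^{(\rho)})^\rho=\gamma^{(\rho)}$. Then for all sufficiently small $t>0$ the matrix $A+tD$ has an eigenvalue $\lambda=\lambda(t)$ with a corresponding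 eigenvector $h=h(t)$ such that, as $t\to0^+$, $$\lambda=\lambda_0+t^{1/\rho}\mu^{(\rho)}+O(t^{2/\rho}),\qquad h=\tilde\Xi_\rho\begin{bmatrix}\varphi\\G_\rho^{(\rho)}\varphi\end{bmatrix}+\sum_{i=1}^k\Xi_ih_i+O(t),$$ where $h_i=h_i(t)$ consists of $i$ blocks of length $s_i$ and, blockwise, $$h_\rho=\begin{bmatrix}0\\(t^{1/\rho}\mu^{(\rho)})\varphi\\\vdots\\(t^{1/\rho}\mu^{(\rho)})^{\rho-1}\varphi\end{bmatrix}+O\left(\begin{bmatrix}t^{1/\rho}\\t^{2/\rho}\\\vdots\\t\end{bmatrix}\right),$$ $$h_i=O\left(\begin{bmatrix}t^{1-i/\rho}&t^{1-(i-1)/\rho}&\cdots&t^{1-1/\rho}\end{bmatrix}^T\right)\quad(1\le i\le\rho-1),$$ $$h_i=O\left(\begin{bmatrix}t^{1/\rho}&t^{1/\rho}&t^{2/\rho}&\cdots&t^{1-1/\rho}&t&\cdots&t\end{bmatrix}^T\right)\quad(\rho+1\le i\le k);$$ that is, for $i>\rho$ the first block of $h_i$ is $O(t^{1/\rho})$ and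 its $\ell$th block is $O(t^{\min(\ell-1,\rho)/\rho})$ for $2\le\ell\le i$. -/

import Mathlib

open Matrix Filter Topology Asymptotics

namespace JordanPert

/-- The set `{1, …, k}` as a type; Jordan block sizes and positions inside a Jordan chain
are both counted from `1`. -/
abbrev Blk (k : ℕ) : Type := Finset.Icc 1 k

/-- The first element of `{1, …, i}`. -/
def first {k : ℕ} (i : Blk k) : Blk (i : ℕ) :=
  ⟨1, Finset.mem_Icc.2 ⟨le_rfl, (Finset.mem_Icc.1 i.2).1⟩⟩

/-- The last element of `{1, …, i}`. -/
def last {k : ℕ} (i : Blk k) : Blk (i : ℕ) :=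
  ⟨i, Finset.mem_Icc.2 ⟨(Finset.mem_Icc.1 i.2).1, le_rfl⟩⟩

/-- Columns belonging to the Jordan blocks of size `i`: `i` groups of `s i` columns each. -/
abbrev BIdx (s : ℕ → ℕ) (i : ℕ) : Type := Blk i × Fin (s i)

/-- All columns belonging to the eigenvalue `λ₀`, grouped by the Jordan block size. -/
abbrev JIdx (k : ℕ) (s : ℕ → ℕ) : Type := Σ i : Blk k, BIdx s (i : ℕ)

/-- One column (or row) group of size `s j` for every `j ∈ {i, i + 1, …, k}`. This type is
empty for `i = k + 1`. -/
abbrev Tail (k : ℕ) (s : ℕ → ℕ) (i : ℕ) : Type :=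
  Σ j : {j : Blk k // i ≤ (j : ℕ)}, Fin (s (j : Blk k))

/-- `N_i`: the `i × i` block matrix with identity blocks of order `s i` on the first block
superdiagonal, and zero blocks elsewhere. -/
def nilBlock (s : ℕ → ℕ) (i : ℕ) : Matrix (BIdx s i) (BIdx s i) ℂ :=
  Matrix.of fun p q => if (p.1 : ℕ) + 1 = (q.1 : ℕ) ∧ p.2 = q.2 then 1 else 0

/-- `N = diag (N_1, …, N_k)`. -/
def nil (k : ℕ) (s : ℕ → ℕ) : Matrix (JIdx k s) (JIdx k s) ℂ :=
  Matrix.blockDiagonal' fun i : Blk k => nilBlock s (i : ℕ)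

section Blocks

variable {n k : ℕ} {s : ℕ → ℕ}

/-- The block column `X_i` of `X = [X_1, …, X_k]`. -/
def colBlock (X : Matrix (Fin n) (JIdx k s) ℂ) (i : Blk k) :
    Matrix (Fin n) (BIdx s (i : ℕ)) ℂ :=
  X.submatrix id fun p => ⟨i, p⟩

/-- The block column `X_{iℓ}` of `X_i = [X_{i1}, …, X_{ii}]`. -/
def colSub (X : Matrix (Fin n) (JIdx k s) ℂ) (i : Blk k) (l : Blk (i : ℕ)) :
    Matrix (Fin n) (Fin (s i)) ℂ :=
  (colBlock X i).submatrix id fun a => (l, a)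

/-- `[X_{i1}, X_{i+1,1}, …, X_{k1}]`. -/
def tailFirst (X : Matrix (Fin n) (JIdx k s) ℂ) (i : ℕ) :
    Matrix (Fin n) (Tail k s i) ℂ :=
  Matrix.of fun r c => colSub X c.1.1 (first c.1.1) r c.2

/-- `[X_{ii}, X_{i+1,i+1}, …, X_{kk}]`. -/
def tailLast (X : Matrix (Fin n) (JIdx k s) ℂ) (i : ℕ) :
    Matrix (Fin n) (Tail k s i) ℂ :=
  Matrix.of fun r c => colSub X c.1.1 (last c.1.1) r c.2

/-- `W_i = [Σ_{ii}, …, Σ_{kk}]ᴴ D [Ξ_{i1}, …, Ξ_{k1}]`. -/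
def W (Xi Sg : Matrix (Fin n) (JIdx k s) ℂ) (D : Matrix (Fin n) (Fin n) ℂ) (i : ℕ) :
    Matrix (Tail k s i) (Tail k s i) ℂ :=
  (tailLast Sg i)ᴴ * D * tailFirst Xi i

/-- `G_ρ = - W_{ρ+1}⁻¹ Z_{ρ+1,ρ}`, where `Z_{ρ+1,ρ}` has the block rows
`Σ_{jj}ᴴ D Ξ_{ρ1}`, `j = ρ + 1, …, k`. -/
noncomputable def G (Xi Sg : Matrix (Fin n) (JIdx k s) ℂ) (D : Matrix (Fin n) (Fin n) ℂ)
    (ρ : Blk k) : Matrix (Tail k s (ρ + 1)) (Fin (s ρ)) ℂ :=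
  -((W Xi Sg D (ρ + 1))⁻¹ * ((tailLast Sg (ρ + 1))ᴴ * D * colSub Xi ρ (first ρ)))

/-- `S_ρ = Σ_{ρρ}ᴴ D Ξ_{ρ1} + W_{ρ,ρ+1} G_ρ`, where `W_{ρ,ρ+1}` has the block columns
`Σ_{ρρ}ᴴ D Ξ_{j1}`, `j = ρ + 1, …, k`. -/
noncomputable def S (Xi Sg : Matrix (Fin n) (JIdx k s) ℂ) (D : Matrix (Fin n) (Fin n) ℂ)
    (ρ : Blk k) : Matrix (Fin (s ρ)) (Fin (s ρ)) ℂ :=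
  (colSub Sg ρ (last ρ))ᴴ * D * colSub Xi ρ (first ρ) +
    ((colSub Sg ρ (last ρ))ᴴ * D * tailFirst Xi (ρ + 1)) * G Xi Sg D ρ

/-- The stacked vector `[φ; u]` with top block `φ` (block number `ρ`) and lower blocks `u`
(block numbers `ρ + 1, …, k`). -/
def stack (ρ : Blk k) (φ : Fin (s ρ) → ℂ) (u : Tail k s (ρ + 1) → ℂ) : Tail k s ρ → ℂ :=
  fun c =>
    if h : (c.1 : Blk k) = ρ then φ (Fin.cast (by rw [h]) c.2)
    else u ⟨⟨c.1, Nat.succ_le_of_lt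
      (lt_of_le_of_ne c.1.2 fun e => h (Subtype.ext e.symm))⟩, c.2⟩

/-- The exponent `e` in the fractional order `t ^ (e / ρ)` of the `l`-th block (`1 ≤ l ≤ i`) of
the remainder in `h_i`:
`(ρ - i, ρ - i + 1, …, ρ - 1)` for `i < ρ`,
`(1, 2, …, ρ)` for `i = ρ`, and
`(1, 1, 2, …, ρ - 1, ρ, …, ρ)` for `i > ρ`. -/
def order (ρ i l : ℕ) : ℕ :=
  if i < ρ then ρ - i + (l - 1)
  else if i = ρ then l
  else if l = 1 then 1
  else min (l - 1) ρ

/-- The explicit part of `h_ρ`: its first block is zero, and its `l`-th block is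
`w ^ (l - 1) • φ` for `2 ≤ l ≤ ρ`. -/
def lead (ρ : ℕ) (φ : Fin (s ρ) → ℂ) (w : ℂ) (l : Blk ρ) : Fin (s ρ) → ℂ :=
  if (l : ℕ) = 1 then 0 else w ^ ((l : ℕ) - 1) • φ

end Blocks

end JordanPert

/-! In the basis `[Ξ, Ξ_c]` the matrix `A + tD` becomes `λ₀ + diag(N, A₂₂ - λ₀) + tE`, where the
entries of `E` that matter are those of `Σᴴ D Ξ`. Put `t = τ^ρ`, write the eigenvalue as `λ₀ + τc`,
and weight each coordinate of the eigenvector by a power of `τ` (`expo`). Every row is then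
divisible by a power of `τ` (`rowExpo`), and dividing it out leaves a pencil `scaled τ - c · weight
τ` polynomial in `τ` (`unscale`). The fractional powers of `t` have disappeared.

At `τ = 0` the perturbation acts only on the leading vectors of chains of length at least `ρ`. The
last rows of longer chains force the leading coefficients there to be `G_ρ φ`. Along a chain of
length `ρ` each block is `μ` times the preceding one, and the last row closes the cycle as `S_ρ φ =
μ^ρ φ` (`exists_limit`). Since `S_ρ` is a Schur complement of `W_ρ`, invertibility of `W_ρ` gives `μ
≠ 0`. The limit eigenpair is simple because `γ` is simple and `ρ μ^(ρ-1) ≠ 0` (`limit_simple`).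

The implicit function theorem (`exists_eigenpair_branch`) continues the limit eigenpair with error
`O(τ)`. Restoring the weights turns this single error into all the blockwise orders. -/

namespace JordanPert

/-! ### Simple eigenpairs and their continuation. -/

/-- A nonlinear eigenpair `(μ, y₀)` of the pencil `B 0 - μ C 0` which is simple, in the sense that
the bordered linearisation has trivial kernel, continues to a branch of eigenpairs of
`B τ - m C τ`. -/
theorem exists_eigenpair_branch {V : Type*} [Fintype V]
    (B C : ℂ → Matrix V V ℂ)
    (hB : ∀ p q, ContDiff ℂ 1 fun τ => B τ p q) (hC : ∀ p q, ContDiff ℂ 1 fun τ => C τ p q)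
    (μ : ℂ) (y₀ : V → ℂ) (q₀ : V) (h₀ : B 0 *ᵥ y₀ = μ • (C 0 *ᵥ y₀))
    (hker : ∀ (δ : ℂ) (u : V → ℂ), B 0 *ᵥ u - μ • (C 0 *ᵥ u) = δ • (C 0 *ᵥ y₀) → u q₀ = 0 →
      δ = 0 ∧ u = 0) :
    ∃ (m : ℂ → ℂ) (y : ℂ → V → ℂ),
      ((fun τ => m τ - μ) =O[𝓝 0] fun τ => τ) ∧
      (∀ q, (fun τ => y τ q - y₀ q) =O[𝓝 0] fun τ => τ) ∧
      ∀ᶠ τ in 𝓝 0, B τ *ᵥ y τ = m τ • (C τ *ᵥ y τ) ∧ y τ q₀ = y₀ q₀ := by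
  -- The last component fixes the scaling of the eigenvector and makes the system square in the
  -- unknowns `(m, y)`.
  set F : ℂ × (ℂ × (V → ℂ)) → (V → ℂ) × ℂ := fun z =>
    (fun p => ∑ q, (B z.1 p q - z.2.1 * C z.1 p q) * z.2.2 q, z.2.2 q₀) with hF
  have hFd : ContDiff ℂ 1 F := by
    have hB' : ∀ p q, ContDiff ℂ 1 fun z : ℂ × (ℂ × (V → ℂ)) => B z.1 p q :=
      fun p q => (hB p q).comp contDiff_fst
    have hC' : ∀ p q, ContDiff ℂ 1 fun z : ℂ × (ℂ × (V → ℂ)) => C z.1 p q :=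
      fun p q => (hC p q).comp contDiff_fst
    have hy : ∀ q, ContDiff ℂ 1 fun z : ℂ × (ℂ × (V → ℂ)) => z.2.2 q := fun q => by fun_prop
    refine ContDiff.prodMk (contDiff_pi.2 fun p => ContDiff.sum fun q _ => ?_) (hy q₀)
    exact ((hB' p q).sub ((by fun_prop : ContDiff ℂ 1 fun z : ℂ × (ℂ × (V → ℂ)) => z.2.1).mul
      (hC' p q))).mul (hy q)
  have hs : HasStrictFDerivAt F (fderiv ℂ F (0, (μ, y₀))) (0, (μ, y₀)) :=
    hFd.contDiffAt.hasStrictFDerivAt one_ne_zero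
  set F' := fderiv ℂ F (0, (μ, y₀))
  -- The partial derivative is read off by differentiating `F` along a line through the base point.
  have hline : ∀ (δ : ℂ) (u : V → ℂ), F' (0, (δ, u)) =
      (fun p => ∑ q, ((B 0 p q - μ * C 0 p q) * u q - δ * C 0 p q * y₀ q), u q₀) := by
    intro δ u
    have hl : HasDerivAt (fun s : ℂ => ((0 : ℂ), (μ + s * δ, y₀ + s • u))) (0, (δ, u)) 0 := by
      refine (hasDerivAt_const _ _).prodMk (HasDerivAt.prodMk ?_ ?_)
      · simpa using ((hasDerivAt_id (0 : ℂ)).mul_const δ).const_add μ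
      · simpa using ((hasDerivAt_id (0 : ℂ)).smul_const u).const_add y₀
    have hd : HasFDerivAt F F' ((0 : ℂ), (μ + (0 : ℂ) * δ, y₀ + (0 : ℂ) • u)) := by
      simpa using hs.hasFDerivAt
    have h1 := hd.comp_hasDerivAt (0 : ℂ) hl
    refine h1.unique ?_
    change HasDerivAt (fun s : ℂ => (fun p => ∑ q, (B 0 p q - (μ + s * δ) * C 0 p q) *
      (y₀ q + s * u q), y₀ q₀ + s * u q₀)) _ 0
    refine HasDerivAt.prodMk (hasDerivAt_pi.2 fun p => HasDerivAt.fun_sum fun q _ => ?_) ?_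
    · have h2 : HasDerivAt (fun s : ℂ => B 0 p q - (μ + s * δ) * C 0 p q) (-(δ * C 0 p q)) 0 := by
        simpa using ((((hasDerivAt_id (0 : ℂ)).mul_const δ).const_add μ).mul_const
          (C 0 p q)).const_sub (B 0 p q)
      have h3 : HasDerivAt (fun s : ℂ => y₀ q + s * u q) (u q) 0 := by
        simpa using ((hasDerivAt_id (0 : ℂ)).mul_const (u q)).const_add (y₀ q)
      refine (h2.fun_mul h3).congr_deriv ?_
      simp
      ring
    · simpa using ((hasDerivAt_id (0 : ℂ)).mul_const (u q₀)).const_add (y₀ q₀)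
  set T : ℂ × (V → ℂ) →L[ℂ] (V → ℂ) × ℂ := F' ∘L .inr ℂ ℂ (ℂ × (V → ℂ))
  have hinj : Function.Injective T := by
    rw [injective_iff_map_eq_zero]
    rintro ⟨δ, u⟩ h
    have h1 : F' (0, (δ, u)) = 0 := h
    rw [hline, Prod.mk_eq_zero] at h1
    have := hker δ u (by
      ext p
      have h2 := congrFun h1.1 p
      simp only [Finset.sum_sub_distrib, Pi.zero_apply, sub_mul] at h2
      simp only [mulVec, dotProduct, Pi.sub_apply, Pi.smul_apply, smul_eq_mul, Finset.mul_sum]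
      simpa only [mul_assoc, sub_eq_zero] using h2) h1.2
    rw [this.1, this.2]; rfl
  have hfin : Module.finrank ℂ (ℂ × (V → ℂ)) = Module.finrank ℂ ((V → ℂ) × ℂ) := by
    simp [add_comm]
  have hTinv : T.IsInvertible := by
    refine ⟨(LinearEquiv.ofInjectiveOfFinrankEq T.toLinearMap hinj hfin).toContinuousLinearEquiv, ?_⟩
    ext x <;> rfl
  have hev := hs.eventually_apply_implicitFunctionOfProdDomain hTinv
  have hd := (hs.hasStrictFDerivAt_implicitFunctionOfProdDomain hTinv).hasFDerivAt
  have hpt := (hs.eventually_apply_eq_iff_implicitFunctionOfProdDomain hTinv).self_of_nhds.mp rfl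
  set ψ := hs.implicitFunctionOfProdDomain hTinv
  have hO : (fun τ => ψ τ - (μ, y₀)) =O[𝓝 0] fun τ => τ := by
    have := hd.isBigO_sub
    simp only [sub_zero] at this
    rw [hpt] at this
    exact this
  refine ⟨fun τ => (ψ τ).1, fun τ => (ψ τ).2, ?_, ?_, ?_⟩
  · exact (isBigO_of_le _ fun τ => by exact norm_fst_le (ψ τ - (μ, y₀))).trans hO
  · intro q
    refine (isBigO_of_le _ fun τ => ?_).trans hO
    exact (norm_le_pi_norm ((ψ τ - (μ, y₀)).2) q).trans (norm_snd_le _)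
  · have hF0 : F (0, (μ, y₀)) = (0, y₀ q₀) := by
      simp only [hF]
      congr 1
      ext p
      have := congrFun h₀ p
      simp only [mulVec, dotProduct, Pi.smul_apply, smul_eq_mul, Finset.mul_sum] at this
      simp only [sub_mul, Finset.sum_sub_distrib, mul_assoc]
      rw [this, sub_self]; rfl
    filter_upwards [hev] with τ hτ
    rw [hF0] at hτ
    have h1 := congrArg Prod.fst hτ
    refine ⟨?_, congrArg Prod.snd hτ⟩
    ext p
    have h2 := congrFun h1 p
    simp only [hF, sub_mul, Finset.sum_sub_distrib, mul_assoc, Pi.zero_apply, sub_eq_zero] at h2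
    simp only [mulVec, dotProduct, Pi.smul_apply, smul_eq_mul, Finset.mul_sum]
    exact h2

/-- At a simple eigenvalue there are no generalized eigenvectors besides the multiples of an
eigenvector. -/
theorem eq_zero_and_exists_smul_of_rootMultiplicity_eq_one {ι : Type*} [Fintype ι] [DecidableEq ι]
    (S : Matrix ι ι ℂ) (γ : ℂ) (hγ : S.charpoly.rootMultiplicity γ = 1) (φ : ι → ℂ) (hφ0 : φ ≠ 0)
    (hφ : S *ᵥ φ = γ • φ) (u : ι → ℂ) (c : ℂ) (hu : S *ᵥ u - γ • u = c • φ) :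
    c = 0 ∧ ∃ α : ℂ, u = α • φ := by
  have hfr : Module.finrank ℂ (Module.End.maxGenEigenspace (toLin' S) γ) = 1 := by
    rw [LinearMap.finrank_maxGenEigenspace_eq]
    simpa using hγ
  have hmφ : φ ∈ Module.End.maxGenEigenspace (toLin' S) γ := by
    rw [Module.End.mem_maxGenEigenspace]
    exact ⟨1, by simp [hφ]⟩
  have hmu : u ∈ Module.End.maxGenEigenspace (toLin' S) γ := by
    rw [Module.End.mem_maxGenEigenspace]
    -- One application of `S - γ` sends `u` to `c • φ`, the second kills it.
    refine ⟨2, ?_⟩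
    rw [pow_two]
    have h1 : (toLin' S - γ • (1 : Module.End ℂ (ι → ℂ))) u = c • φ := by
      rw [← hu]; simp
    rw [Module.End.mul_apply, h1]
    simp [hφ]
  have hα : ∃ α : ℂ, u = α • φ := by
    obtain ⟨α, h⟩ := (finrank_eq_one_iff_of_nonzero' (⟨φ, hmφ⟩ :
      Module.End.maxGenEigenspace (toLin' S) γ) (fun h => hφ0 (congrArg Subtype.val h))).1 hfr
        ⟨u, hmu⟩
    exact ⟨α, (congrArg Subtype.val h).symm⟩
  refine ⟨?_, hα⟩
  obtain ⟨α, rfl⟩ := hα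
  rw [mulVec_smul, hφ, smul_comm, sub_self] at hu
  exact (smul_eq_zero.1 hu.symm).resolve_right hφ0

/-! ### Chains of length at least `ρ`: heads and longer tails. -/

section Indices

variable {k m : ℕ} {s : ℕ → ℕ}

/-- The index of the first column of the chain belonging to `c`. -/
def firstIdx (m : ℕ) (i : ℕ) (c : Tail k s i) : JIdx k s ⊕ Fin m :=
  Sum.inl ⟨c.1.1, (first c.1.1, c.2)⟩

/-- The index of the last column of the chain belonging to `c`. -/
def lastIdx (m : ℕ) (i : ℕ) (c : Tail k s i) : JIdx k s ⊕ Fin m :=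
  Sum.inl ⟨c.1.1, (last c.1.1, c.2)⟩

/-- The index of the first column of the `a`-th chain of length `ρ`. -/
def headFirst (m : ℕ) (ρ : Blk k) (a : Fin (s ρ)) : JIdx k s ⊕ Fin m :=
  Sum.inl ⟨ρ, (first ρ, a)⟩

/-- The index of the last column of the `a`-th chain of length `ρ`. -/
def headLast (m : ℕ) (ρ : Blk k) (a : Fin (s ρ)) : JIdx k s ⊕ Fin m :=
  Sum.inl ⟨ρ, (last ρ, a)⟩

/-- The chains of length `ρ` among the chains of length at least `ρ`. -/
def tailHead (ρ : Blk k) (a : Fin (s ρ)) : Tail k s ρ := ⟨⟨ρ, le_rfl⟩, a⟩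

/-- The chains of length more than `ρ` among the chains of length at least `ρ`. -/
def tailTail (ρ : Blk k) (c : Tail k s (ρ + 1)) : Tail k s ρ :=
  ⟨⟨c.1.1, (Nat.le_succ _).trans c.1.2⟩, c.2⟩

theorem tail_cases (ρ : Blk k) (c : Tail k s ρ) :
    (∃ a, c = tailHead ρ a) ∨ ∃ c', c = tailTail ρ c' := by
  obtain ⟨⟨j, hj⟩, a⟩ := c
  by_cases h : j = ρ
  · subst h
    exact Or.inl ⟨a, rfl⟩
  · exact Or.inr ⟨⟨⟨j, Nat.succ_le_of_lt (lt_of_le_of_ne hj fun e => h (Subtype.ext e.symm))⟩, a⟩,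
      rfl⟩

theorem tailHead_ne_tailTail (ρ : Blk k) (a : Fin (s ρ)) (c : Tail k s (ρ + 1)) :
    tailHead ρ a ≠ tailTail ρ c := by
  intro h
  have h1 : (ρ : ℕ) = (c.1.1 : ℕ) := congrArg (fun c : Tail k s ρ => (c.1.1 : ℕ)) h
  have := c.1.2
  omega

theorem tailTail_injective (ρ : Blk k) : Function.Injective (tailTail (s := s) ρ) := by
  rintro ⟨⟨j, hj⟩, a⟩ ⟨⟨j', hj'⟩, a'⟩ h
  simp only [tailTail, Sigma.mk.injEq, Subtype.mk.injEq] at h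
  obtain ⟨rfl, h⟩ := h
  cases h
  rfl

theorem tailHead_injective (ρ : Blk k) : Function.Injective (tailHead (s := s) ρ) := by
  intro a a' h
  simpa [tailHead] using h

theorem sum_tail {M : Type*} [AddCommMonoid M] (ρ : Blk k) (f : Tail k s ρ → M) :
    ∑ c, f c = ∑ a, f (tailHead ρ a) + ∑ c, f (tailTail ρ c) := by
  have hbij : Function.Bijective (Sum.elim (tailHead (s := s) ρ) (tailTail ρ)) := by
    refine ⟨(tailHead_injective ρ).sumElim (tailTail_injective ρ)
      (tailHead_ne_tailTail ρ), fun c => ?_⟩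
    rcases tail_cases ρ c with ⟨a, rfl⟩ | ⟨c', rfl⟩
    · exact ⟨Sum.inl a, rfl⟩
    · exact ⟨Sum.inr c', rfl⟩
  rw [← hbij.sum_comp, Fintype.sum_sum_type]
  rfl

theorem stack_tailHead (ρ : Blk k) (φ : Fin (s ρ) → ℂ) (u : Tail k s (ρ + 1) → ℂ) (a : Fin (s ρ)) :
    stack ρ φ u (tailHead ρ a) = φ a := by
  simp [stack, tailHead]

theorem stack_tailTail (ρ : Blk k) (φ : Fin (s ρ) → ℂ) (u : Tail k s (ρ + 1) → ℂ)
    (c : Tail k s (ρ + 1)) : stack ρ φ u (tailTail ρ c) = u c := by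
  have h : (c.1.1 : Blk k) ≠ ρ := by
    intro h
    have := c.1.2
    rw [h] at this
    omega
  simp [stack, tailTail, h]

theorem firstIdx_injective (i : ℕ) : Function.Injective (firstIdx (k := k) (s := s) m i) := by
  rintro ⟨⟨j, hj⟩, a⟩ ⟨⟨j', hj'⟩, a'⟩ h
  simp only [firstIdx, Sum.inl.injEq, Sigma.mk.injEq] at h
  obtain ⟨rfl, h⟩ := h
  simpa using h

theorem headLast_injective (ρ : Blk k) : Function.Injective (headLast (s := s) m ρ) := by
  intro a a' h
  simpa [headLast] using h

/-! ### The rescaled eigenvalue equation. -/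

/-- The order in `τ = t ^ (1 / ρ)` of the coordinates of the eigenvector. -/
def expo (ρ : ℕ) : JIdx k s ⊕ Fin m → ℕ
  | Sum.inl ⟨i, (l, _)⟩ =>
      if (i : ℕ) < ρ then ρ - i + ((l : ℕ) - 1) else min ((l : ℕ) - 1) ρ
  | Sum.inr _ => ρ

/-- The power of `τ` which can be divided out of a row of the eigenvalue equation. -/
def rowExpo (ρ : ℕ) (p : JIdx k s ⊕ Fin m) : ℕ := min (expo ρ p + 1) ρ

theorem expo_inl (ρ : ℕ) (i : Blk k) (l : Blk i) (a : Fin (s i)) :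
    expo (m := m) ρ (Sum.inl ⟨i, (l, a)⟩) =
      if (i : ℕ) < ρ then ρ - i + ((l : ℕ) - 1) else min ((l : ℕ) - 1) ρ := rfl

theorem expo_firstIdx (ρ : Blk k) (c : Tail k s ρ) : expo ρ (firstIdx m ρ c) = 0 := by
  have := c.1.2
  rw [firstIdx, expo_inl, if_neg (by omega)]
  simp [first]

theorem exists_eq_firstIdx_of_expo_eq_zero (ρ : Blk k) (q : JIdx k s ⊕ Fin m)
    (h : expo ρ q = 0) : ∃ c : Tail k s ρ, q = firstIdx m ρ c := by
  have hρ := (Finset.mem_Icc.1 ρ.2).1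
  rcases q with ⟨i, l, a⟩ | q
  · rw [expo_inl] at h
    have hl := (Finset.mem_Icc.1 l.2)
    have hi : (ρ : ℕ) ≤ i := by
      by_contra hi
      rw [if_pos (by omega)] at h
      omega
    rw [if_neg (by omega)] at h
    refine ⟨⟨⟨i, hi⟩, a⟩, ?_⟩
    have : l = first i := Subtype.ext (by simp only [first]; omega)
    rw [this]
    rfl
  · change (ρ : ℕ) = 0 at h
    omega

theorem exists_of_nil_ne_zero {p q : JIdx k s} (h : nil k s p q ≠ 0) :
    ∃ (i : Blk k) (l l' : Blk i) (a : Fin (s i)), p = ⟨i, (l, a)⟩ ∧ q = ⟨i, (l', a)⟩ ∧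
      (l : ℕ) + 1 = l' := by
  obtain ⟨i, l, a⟩ := p
  obtain ⟨j, l', a'⟩ := q
  rw [nil, blockDiagonal'_apply] at h
  split_ifs at h with hij
  · dsimp only at hij
    subst hij
    simp only [cast_eq, nilBlock, of_apply] at h
    split_ifs at h with h2
    · obtain ⟨h2, rfl⟩ := h2
      exact ⟨i, l, l', a, rfl, rfl, h2⟩
    · exact absurd rfl h
  · exact absurd rfl h

theorem nil_succ (i : Blk k) (l l' : Blk i) (h : (l : ℕ) + 1 = l') (a : Fin (s i)) :
    nil k s ⟨i, (l, a)⟩ ⟨i, (l', a)⟩ = 1 := by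
  simp [nil, blockDiagonal'_apply, nilBlock, h]

/-- `diag (N, C)`. -/
def shifted (s : ℕ → ℕ) (C : Matrix (Fin m) (Fin m) ℂ) :
    Matrix (JIdx k s ⊕ Fin m) (JIdx k s ⊕ Fin m) ℂ :=
  fromBlocks (nil k s) 0 0 C

/-- Along a chain the exponent grows by one per step until it is capped at `ρ`, so the nilpotent
part survives division of the row. This also makes the truncated subtraction in `scaled` harmless:
it truncates only where the entry of `shifted` vanishes. -/
theorem rowExpo_le_expo (ρ : ℕ) (C : Matrix (Fin m) (Fin m) ℂ) (p q : JIdx k s ⊕ Fin m)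
    (h : shifted s C p q ≠ 0) : rowExpo ρ p ≤ expo ρ q := by
  rcases p with p | p <;> rcases q with q | q
  · obtain ⟨i, l, l', a, rfl, rfl, hl⟩ := exists_of_nil_ne_zero h
    have h1 := Finset.mem_Icc.1 l.2
    rw [rowExpo, expo_inl, expo_inl]
    split_ifs <;> omega
  · exact absurd rfl h
  · exact absurd rfl h
  · simp [rowExpo, expo]

/-- The matrix of the rescaled eigenvalue equation, without the eigenvalue. -/
noncomputable def scaled (ρ : ℕ) (C : Matrix (Fin m) (Fin m) ℂ)
    (E : Matrix (JIdx k s ⊕ Fin m) (JIdx k s ⊕ Fin m) ℂ) (τ : ℂ) :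
    Matrix (JIdx k s ⊕ Fin m) (JIdx k s ⊕ Fin m) ℂ :=
  of fun p q => shifted s C p q * τ ^ (expo ρ q - rowExpo ρ p) +
    τ ^ (ρ + expo ρ q - rowExpo ρ p) * E p q

/-- The weights of the eigenvalue in the rescaled eigenvalue equation. -/
noncomputable def weight (k m : ℕ) (s : ℕ → ℕ) (ρ : ℕ) (τ : ℂ) :
    Matrix (JIdx k s ⊕ Fin m) (JIdx k s ⊕ Fin m) ℂ :=
  diagonal fun p => τ ^ (expo ρ p + 1 - rowExpo ρ p)

/-- Multiplying row `p` by `τ ^ rowExpo ρ p` restores the original equation; no division by `τ`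
occurs, so `τ = 0` needs no separate treatment. -/
theorem unscale (ρ : ℕ) (C : Matrix (Fin m) (Fin m) ℂ)
    (E : Matrix (JIdx k s ⊕ Fin m) (JIdx k s ⊕ Fin m) ℂ) (τ c : ℂ) (y : JIdx k s ⊕ Fin m → ℂ)
    (h : scaled ρ C E τ *ᵥ y = c • (weight k m s ρ τ *ᵥ y)) :
    (shifted s C + τ ^ ρ • E) *ᵥ (fun q => τ ^ expo ρ q * y q) =
      (τ * c) • fun q => τ ^ expo ρ q * y q := by
  ext p
  have h1 := congrArg (fun z => τ ^ rowExpo ρ p * z) (congrFun h p)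
  have hr : rowExpo ρ p ≤ expo ρ p + 1 := min_le_left _ _
  have hr' : rowExpo ρ p ≤ ρ := min_le_right _ _
  simp only [weight, mulVec_diagonal, Pi.smul_apply, smul_eq_mul] at h1
  have e1 : τ ^ rowExpo ρ p * (c * (τ ^ (expo ρ p + 1 - rowExpo ρ p) * y p)) =
      τ * c * (τ ^ expo ρ p * y p) := by
    calc _ = τ ^ rowExpo ρ p * τ ^ (expo ρ p + 1 - rowExpo ρ p) * (c * y p) := by ring
      _ = _ := by rw [← pow_add, Nat.add_sub_cancel' hr]; ring
  rw [e1] at h1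
  simp only [Pi.smul_apply, smul_eq_mul]
  rw [← h1]
  simp only [mulVec, dotProduct, Finset.mul_sum]
  refine Finset.sum_congr rfl fun q _ => ?_
  simp only [scaled, of_apply, Matrix.add_apply, Matrix.smul_apply, smul_eq_mul]
  have e2 : shifted s C p q * τ ^ expo ρ q =
      τ ^ rowExpo ρ p * (shifted s C p q * τ ^ (expo ρ q - rowExpo ρ p)) := by
    by_cases h0 : shifted s C p q = 0
    · simp [h0]
    · rw [mul_left_comm, ← pow_add, Nat.add_sub_cancel' (rowExpo_le_expo ρ C p q h0)]
  have e3 : τ ^ ρ * τ ^ expo ρ q =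
      τ ^ rowExpo ρ p * τ ^ (ρ + expo ρ q - rowExpo ρ p) := by
    rw [← pow_add, ← pow_add, Nat.add_sub_cancel' (by omega)]
  linear_combination y q * e2 + y q * E p q * e3

/-- The contribution of the perturbation to the rescaled equation at `τ = 0`. -/
noncomputable def pertTerm (ρ : ℕ) (E : Matrix (JIdx k s ⊕ Fin m) (JIdx k s ⊕ Fin m) ℂ)
    (u : JIdx k s ⊕ Fin m → ℂ) (p : JIdx k s ⊕ Fin m) : ℂ :=
  ∑ q, (0 : ℂ) ^ (ρ + expo ρ q - rowExpo ρ p) * E p q * u q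

/-! ### Rows of the limit problem `τ = 0`. -/

section Rows

variable (ρ : Blk k) (C : Matrix (Fin m) (Fin m) ℂ)
  (E : Matrix (JIdx k s ⊕ Fin m) (JIdx k s ⊕ Fin m) ℂ) (u : JIdx k s ⊕ Fin m → ℂ)

theorem scaled_zero_mulVec (p : JIdx k s ⊕ Fin m) :
    (scaled ρ C E 0 *ᵥ u) p =
      ∑ q, shifted s C p q * (0 : ℂ) ^ (expo ρ q - rowExpo ρ p) * u q + pertTerm ρ E u p := by
  simp only [mulVec, dotProduct, scaled, of_apply, pertTerm, add_mul, Finset.sum_add_distrib]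

theorem weight_zero_mulVec (p : JIdx k s ⊕ Fin m) :
    (weight k m s ρ 0 *ᵥ u) p = (0 : ℂ) ^ (expo ρ p + 1 - rowExpo ρ p) * u p := by
  simp only [weight, mulVec_diagonal]

/-- On a superdiagonal entry the column exponent equals the row exponent, so that entry keeps its
coefficient `1` in the limit. -/
theorem scaled_zero_row_succ (i : Blk k) (l l' : Blk i) (h : (l : ℕ) + 1 = l') (a : Fin (s i)) :
    (scaled ρ C E 0 *ᵥ u) (Sum.inl ⟨i, (l, a)⟩) =
      u (Sum.inl ⟨i, (l', a)⟩) + pertTerm ρ E u (Sum.inl ⟨i, (l, a)⟩) := by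
  rw [scaled_zero_mulVec, Fintype.sum_eq_single (Sum.inl ⟨i, (l', a)⟩)]
  · have h1 := Finset.mem_Icc.1 l.2
    have h2 := Finset.mem_Icc.1 l'.2
    have h3 : expo (m := m) ρ (Sum.inl ⟨i, (l', a)⟩) - rowExpo (m := m) ρ (Sum.inl ⟨i, (l, a)⟩) = 0 := by
      rw [rowExpo, expo_inl, expo_inl]
      split_ifs <;> omega
    rw [h3, shifted, fromBlocks_apply₁₁, nil_succ i l l' h a]
    simp
  · intro q hq
    rcases q with q | q
    · have : nil k s ⟨i, (l, a)⟩ q = 0 := by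
        by_contra h0
        obtain ⟨i', l₁, l₂, a', e1, rfl, e3⟩ := exists_of_nil_ne_zero h0
        cases e1
        exact hq (by rw [show l₂ = l' from Subtype.ext (by omega)])
      simp [shifted, this]
    · simp [shifted]

theorem scaled_zero_row_last (i : Blk k) (a : Fin (s i)) :
    (scaled ρ C E 0 *ᵥ u) (Sum.inl ⟨i, (last i, a)⟩) =
      pertTerm ρ E u (Sum.inl ⟨i, (last i, a)⟩) := by
  rw [scaled_zero_mulVec, Finset.sum_eq_zero, zero_add]
  intro q _
  rcases q with q | q
  · have : nil k s ⟨i, (last i, a)⟩ q = 0 := by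
      by_contra h0
      obtain ⟨i', l₁, l₂, a', e1, rfl, e3⟩ := exists_of_nil_ne_zero h0
      cases e1
      have := Finset.mem_Icc.1 l₂.2
      simp only [last] at e3
      omega
    simp [shifted, this]
  · simp [shifted]

theorem scaled_zero_row_inr (j : Fin m) :
    (scaled ρ C E 0 *ᵥ u) (Sum.inr j) =
      (C *ᵥ fun j' => u (Sum.inr j')) j + pertTerm ρ E u (Sum.inr j) := by
  rw [scaled_zero_mulVec]
  congr 1
  simp [Fintype.sum_sum_type, shifted, mulVec, dotProduct, rowExpo, expo]

theorem pertTerm_eq_zero_of_rowExpo_lt (p : JIdx k s ⊕ Fin m) (h : rowExpo ρ p < ρ) :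
    pertTerm ρ E u p = 0 := by
  refine Finset.sum_eq_zero fun q _ => ?_
  rw [zero_pow (by omega), zero_mul, zero_mul]

theorem pertTerm_eq_zero_of_first (h : ∀ c : Tail k s ρ, u (firstIdx m ρ c) = 0)
    (p : JIdx k s ⊕ Fin m) : pertTerm ρ E u p = 0 := by
  refine Finset.sum_eq_zero fun q _ => ?_
  by_cases h0 : expo ρ q = 0
  · obtain ⟨c, rfl⟩ := exists_eq_firstIdx_of_expo_eq_zero ρ q h0
    rw [h, mul_zero]
  · have : rowExpo ρ p ≤ ρ := min_le_right _ _
    rw [zero_pow (by omega), zero_mul, zero_mul]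

/-- With `rowExpo ρ p = ρ` the factor `0 ^ expo ρ q` selects the columns of exponent zero, which are
the leading vectors of chains of length at least `ρ`. -/
theorem pertTerm_eq_sum (p : JIdx k s ⊕ Fin m) (h : rowExpo ρ p = ρ) :
    pertTerm ρ E u p = ∑ a, E p (headFirst m ρ a) * u (headFirst m ρ a) +
      ∑ c, E p (firstIdx m (ρ + 1) c) * u (firstIdx m (ρ + 1) c) := by
  have h1 : ∑ c : Tail k s ρ, E p (firstIdx m ρ c) * u (firstIdx m ρ c) = pertTerm ρ E u p := by
    refine Fintype.sum_of_injective _ (firstIdx_injective (m := m) ρ) _ _ (fun q hq => ?_)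
      fun c => ?_
    · have : expo ρ q ≠ 0 := fun h0 => by
        obtain ⟨c, rfl⟩ := exists_eq_firstIdx_of_expo_eq_zero ρ q h0
        exact hq ⟨c, rfl⟩
      rw [zero_pow (by omega), zero_mul, zero_mul]
    · rw [h, expo_firstIdx]
      simp
  rw [← h1, sum_tail]
  rfl

end Rows

theorem expo_last (ρ : Blk k) (i : Blk k) (a : Fin (s i)) :
    expo (m := m) ρ (Sum.inl ⟨i, (last i, a)⟩) = if (i : ℕ) ≤ ρ then (ρ : ℕ) - 1 else ρ := by
  have hi := Finset.mem_Icc.1 i.2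
  rw [expo_inl]
  simp only [last]
  split_ifs <;> omega

theorem rowExpo_last (ρ : Blk k) (i : Blk k) (a : Fin (s i)) :
    rowExpo (m := m) ρ (Sum.inl ⟨i, (last i, a)⟩) = ρ := by
  have hρ := Finset.mem_Icc.1 ρ.2
  rw [rowExpo, expo_last]
  split_ifs <;> omega

/-! ### The reduced matrices and the limit eigenpair. -/

section Reduced

variable (E : Matrix (JIdx k s ⊕ Fin m) (JIdx k s ⊕ Fin m) ℂ)

/-- `W_i` in the coordinates of the Jordan basis. -/
def tailW (i : ℕ) : Matrix (Tail k s i) (Tail k s i) ℂ :=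
  E.submatrix (lastIdx m i) (firstIdx m i)

/-- `G_ρ` in the coordinates of the Jordan basis. -/
noncomputable def tailG (ρ : Blk k) : Matrix (Tail k s (ρ + 1)) (Fin (s ρ)) ℂ :=
  -((tailW E (ρ + 1))⁻¹ * E.submatrix (lastIdx m (ρ + 1)) (headFirst m ρ))

/-- `S_ρ` in the coordinates of the Jordan basis. -/
noncomputable def headS (ρ : Blk k) : Matrix (Fin (s ρ)) (Fin (s ρ)) ℂ :=
  E.submatrix (headLast m ρ) (headFirst m ρ) +
    E.submatrix (headLast m ρ) (firstIdx m (ρ + 1)) * tailG E ρ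

variable (ρ : Blk k) (C : Matrix (Fin m) (Fin m) ℂ) (u : JIdx k s ⊕ Fin m → ℂ)

theorem mulVec_tailG (hW : IsUnit (tailW E (ρ + 1))) (x : Fin (s ρ) → ℂ) :
    tailW E (ρ + 1) *ᵥ (tailG E ρ *ᵥ x) =
      -(E.submatrix (lastIdx m (ρ + 1)) (headFirst m ρ) *ᵥ x) := by
  rw [tailG, neg_mulVec, mulVec_neg, mulVec_mulVec, ← Matrix.mul_assoc,
    Matrix.mul_nonsing_inv _ ((Matrix.isUnit_iff_isUnit_det _).1 hW), Matrix.one_mul]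

/-- The last rows of the longer chains read `W_{ρ+1} u_tail + Z u_head = 0`, which is solved by
inverting `W_{ρ+1}`. -/
theorem tail_eq_tailG (hW : IsUnit (tailW E (ρ + 1)))
    (h : ∀ c, (scaled ρ C E 0 *ᵥ u) (lastIdx m (ρ + 1) c) = 0) :
    (fun c => u (firstIdx m (ρ + 1) c)) = tailG E ρ *ᵥ fun a => u (headFirst m ρ a) := by
  apply Matrix.mulVec_injective_of_isUnit hW
  rw [mulVec_tailG E ρ hW]
  ext c
  have h1 := h c
  rw [lastIdx, scaled_zero_row_last, pertTerm_eq_sum _ _ _ _ (rowExpo_last _ _ _)] at h1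
  exact eq_neg_of_add_eq_zero_right h1

theorem scaled_zero_headLast
    (h : (fun c => u (firstIdx m (ρ + 1) c)) = tailG E ρ *ᵥ fun a => u (headFirst m ρ a))
    (a : Fin (s ρ)) :
    (scaled ρ C E 0 *ᵥ u) (headLast m ρ a) = (headS E ρ *ᵥ fun a => u (headFirst m ρ a)) a := by
  rw [headLast, scaled_zero_row_last, pertTerm_eq_sum _ _ _ _ (rowExpo_last _ _ _), headS,
    add_mulVec, ← mulVec_mulVec, ← h]
  rfl

/-- A Schur complement argument: a kernel vector `φ` of `S_ρ` would give the kernel vector `[φ; G_ρ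
φ]` of `W_ρ`. -/
theorem headS_eigenvalue_ne_zero (hW : IsUnit (tailW E ρ)) (hW' : IsUnit (tailW E (ρ + 1)))
    (φ : Fin (s ρ) → ℂ) (hφ0 : φ ≠ 0) (γ : ℂ) (hφ : headS E ρ *ᵥ φ = γ • φ) : γ ≠ 0 := by
  rintro rfl
  rw [zero_smul] at hφ
  have hz : stack ρ φ (tailG E ρ *ᵥ φ) = 0 := by
    apply Matrix.mulVec_injective_of_isUnit hW
    rw [mulVec_zero]
    ext c
    simp only [mulVec, dotProduct, Pi.zero_apply]
    rw [sum_tail]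
    simp only [stack_tailHead, stack_tailTail]
    rcases tail_cases ρ c with ⟨a, rfl⟩ | ⟨c', rfl⟩
    · rw [headS, add_mulVec, ← mulVec_mulVec] at hφ
      exact congrFun hφ a
    · have := congrFun (mulVec_tailG E ρ hW' φ) c'
      exact add_eq_zero_iff_eq_neg'.2 this
  exact hφ0 (funext fun a => by
    rw [← stack_tailHead ρ φ (tailG E ρ *ᵥ φ), hz]; rfl)

variable {E ρ C u}

theorem weight_exponent_eq_zero (p : JIdx k s ⊕ Fin m) (h : expo ρ p < ρ) :
    expo ρ p + 1 - rowExpo ρ p = 0 := by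
  rw [rowExpo]; omega

/-- With the heads zero, all leading coefficients vanish through `G_ρ`, and so does the whole
perturbation term. Chains of length at least `ρ` are then cleared upward from their first block.
Shorter chains are cleared downward from the last block, using `μ ≠ 0`, and the complement is
cleared by invertibility of `C`. -/
theorem eq_zero_of_rows {μ : ℂ} (hμ : μ ≠ 0) (hW : IsUnit (tailW E (ρ + 1))) (hC : IsUnit C)
    (hrow : ∀ p, (∀ a, headLast m ρ a ≠ p) →
      (scaled ρ C E 0 *ᵥ u) p = μ * (weight k m s ρ 0 *ᵥ u) p)
    (hhead : ∀ a, u (headFirst m ρ a) = 0) : u = 0 := by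
  have hlast : ∀ c, (scaled ρ C E 0 *ᵥ u) (lastIdx m (ρ + 1) c) = 0 := by
    intro c
    have hc := c.1.2
    rw [hrow, weight_zero_mulVec, lastIdx, zero_pow, zero_mul, mul_zero]
    · rw [rowExpo, expo_last, if_neg (by omega)]
      omega
    · intro a h
      have h1 := Sum.inl.inj h
      have h2 : (ρ : ℕ) = (c.1.1 : ℕ) := congrArg (fun x : JIdx k s => (x.1 : ℕ)) h1
      omega
  have htail := tail_eq_tailG E ρ C u hW hlast
  have hfirst : ∀ c : Tail k s ρ, u (firstIdx m ρ c) = 0 := by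
    intro c
    rcases tail_cases ρ c with ⟨a, rfl⟩ | ⟨c', rfl⟩
    · exact hhead a
    · have := congrFun htail c'
      simp only [hhead] at this
      exact this.trans (congrFun (mulVec_zero _) c')
  have hpert := pertTerm_eq_zero_of_first ρ E u hfirst
  have hsucc : ∀ (i : Blk k) (l l' : Blk i) (_ : (l : ℕ) + 1 = l') (a : Fin (s i)),
      u (Sum.inl ⟨i, (l', a)⟩) = μ * ((0 : ℂ) ^ (expo (m := m) ρ (Sum.inl ⟨i, (l, a)⟩) + 1 -
        rowExpo (m := m) ρ (Sum.inl ⟨i, (l, a)⟩)) * u (Sum.inl ⟨i, (l, a)⟩)) := by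
    intro i l l' h a
    rw [← weight_zero_mulVec, ← hrow, scaled_zero_row_succ ρ C E u i l l' h, hpert, add_zero]
    intro a' h'
    cases h'
    have := Finset.mem_Icc.1 l'.2
    simp only [last] at h
    omega
  ext p
  rcases p with ⟨i, l, a⟩ | j
  · obtain ⟨l, hl⟩ := l
    have hl' := Finset.mem_Icc.1 hl
    by_cases hi : (ρ : ℕ) ≤ i
    · induction l with
      | zero => omega
      | succ l ih =>
        rcases Nat.eq_zero_or_pos l with rfl | h0
        · exact hfirst ⟨⟨i, hi⟩, a⟩
        · have hm : l ∈ Finset.Icc 1 (i : ℕ) := Finset.mem_Icc.2 ⟨h0, by omega⟩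
          rw [hsucc i ⟨l, hm⟩ ⟨l + 1, hl⟩ rfl, ih hm (Finset.mem_Icc.1 hm)]
          simp
    · have hlt : ∀ l : Blk i, expo (m := m) ρ (Sum.inl ⟨i, (l, a)⟩) < ρ := by
        intro l
        have := Finset.mem_Icc.1 l.2
        rw [expo_inl, if_pos (by omega)]
        omega
      induction hd : (i : ℕ) - l generalizing l with
      | zero =>
        obtain rfl : l = i := by omega
        have h1 := hrow (Sum.inl ⟨i, (last i, a)⟩) (fun a' h' => by
          have h2 : (ρ : ℕ) = (i : ℕ) :=
            congrArg (fun x : JIdx k s => (x.1 : ℕ)) (Sum.inl.inj h')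
          omega)
        rw [scaled_zero_row_last, hpert, weight_zero_mulVec, weight_exponent_eq_zero _ (hlt _),
          pow_zero, one_mul] at h1
        exact (mul_eq_zero.1 h1.symm).resolve_left hμ
      | succ d ih =>
        have hm : l + 1 ∈ Finset.Icc 1 (i : ℕ) := Finset.mem_Icc.2 ⟨by omega, by omega⟩
        have h1 := hsucc i ⟨l, hl⟩ ⟨l + 1, hm⟩ rfl a
        rw [ih (l + 1) hm (Finset.mem_Icc.1 hm) (by omega), weight_exponent_eq_zero _ (hlt _),
          pow_zero, one_mul] at h1
        exact (mul_eq_zero.1 h1.symm).resolve_left hμ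
  · have hz : (fun j' => u (Sum.inr j')) = 0 := by
      apply Matrix.mulVec_injective_of_isUnit hC
      rw [mulVec_zero]
      ext j
      have h1 := hrow (Sum.inr j) (fun a => by simp [headLast])
      rw [scaled_zero_row_inr, hpert, add_zero, weight_zero_mulVec, rowExpo] at h1
      rw [h1, zero_pow]
      · simp
      · simp [expo]
    exact congrFun hz j

/-- Replacing the last rows of the chains of length `ρ` by the prescription of their heads gives a
square system. It is injective by `eq_zero_of_rows`, hence solvable. -/
theorem exists_rows {μ : ℂ} (hμ : μ ≠ 0) (hW : IsUnit (tailW E (ρ + 1))) (hC : IsUnit C)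
    (φ : Fin (s ρ) → ℂ) :
    ∃ y : JIdx k s ⊕ Fin m → ℂ, (∀ p, (∀ a, headLast m ρ a ≠ p) →
      (scaled ρ C E 0 *ᵥ y) p = μ * (weight k m s ρ 0 *ᵥ y) p) ∧
      ∀ a, y (headFirst m ρ a) = φ a := by
  classical
  let T : (JIdx k s ⊕ Fin m → ℂ) →ₗ[ℂ] (JIdx k s ⊕ Fin m → ℂ) :=
    LinearMap.pi fun p => if h : ∃ a, headLast m ρ a = p then LinearMap.proj (headFirst m ρ h.choose)
      else LinearMap.proj p ∘ₗ (scaled ρ C E 0 - μ • weight k m s ρ 0).mulVecLin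
  have hT1 : ∀ u p, (∀ a, headLast m ρ a ≠ p) →
      T u p = (scaled ρ C E 0 *ᵥ u) p - μ * (weight k m s ρ 0 *ᵥ u) p := by
    intro u p h
    have h' : ¬ ∃ a, headLast m ρ a = p := by simpa using h
    simp only [T, LinearMap.pi_apply, dif_neg h']
    simp
  have hT2 : ∀ u a, T u (headLast m ρ a) = u (headFirst m ρ a) := by
    intro u a
    have h' : ∃ a', headLast m ρ a' = headLast m ρ a := ⟨a, rfl⟩
    simp only [T, LinearMap.pi_apply, dif_pos h']
    rw [headLast_injective ρ h'.choose_spec]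
    rfl
  have hinj : Function.Injective T := by
    rw [injective_iff_map_eq_zero]
    intro u hu
    refine eq_zero_of_rows hμ hW hC (fun p hp => ?_) fun a => ?_
    · rw [← sub_eq_zero, ← hT1 u p hp, hu]; rfl
    · rw [← hT2 u, hu]; rfl
  obtain ⟨y, hy⟩ := LinearMap.injective_iff_surjective.1 hinj
    (fun p => if h : ∃ a, headLast m ρ a = p then φ h.choose else 0)
  refine ⟨y, fun p hp => ?_, fun a => ?_⟩
  · have h' : ¬ ∃ a, headLast m ρ a = p := by simpa using hp
    rw [← sub_eq_zero, ← hT1 y p hp, hy]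
    simp only [dif_neg h']
  · have h' : ∃ a', headLast m ρ a' = headLast m ρ a := ⟨a, rfl⟩
    rw [← hT2 y, hy]
    simp only [dif_pos h']
    rw [headLast_injective ρ h'.choose_spec]

theorem expo_rho (l : Blk (ρ : ℕ)) (a : Fin (s ρ)) :
    expo (m := m) ρ (Sum.inl ⟨ρ, (l, a)⟩) = (l : ℕ) - 1 := by
  have := Finset.mem_Icc.1 l.2
  rw [expo_inl, if_neg (by omega)]
  omega

theorem head_row_succ (l l' : Blk (ρ : ℕ)) (h : (l : ℕ) + 1 = l') (a : Fin (s ρ)) :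
    (scaled ρ C E 0 *ᵥ u) (Sum.inl ⟨ρ, (l, a)⟩) = u (Sum.inl ⟨ρ, (l', a)⟩) := by
  have h1 := Finset.mem_Icc.1 l.2
  have h2 := Finset.mem_Icc.1 l'.2
  rw [scaled_zero_row_succ ρ C E u ρ l l' h, pertTerm_eq_zero_of_rowExpo_lt, add_zero]
  rw [rowExpo, expo_rho]
  omega

theorem weight_head (l : Blk (ρ : ℕ)) (a : Fin (s ρ)) :
    (weight k m s ρ 0 *ᵥ u) (Sum.inl ⟨ρ, (l, a)⟩) = u (Sum.inl ⟨ρ, (l, a)⟩) := by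
  have h1 := Finset.mem_Icc.1 l.2
  rw [weight_zero_mulVec, weight_exponent_eq_zero, pow_zero, one_mul]
  rw [expo_rho]
  omega

theorem weight_lastIdx (c : Tail k s (ρ + 1)) :
    (weight k m s ρ 0 *ᵥ u) (lastIdx m (ρ + 1) c) = 0 := by
  have hc := c.1.2
  rw [weight_zero_mulVec, lastIdx, zero_pow, zero_mul]
  rw [rowExpo, expo_last, if_neg (by omega)]
  omega

theorem chain_eq {μ : ℂ} (y : JIdx k s ⊕ Fin m → ℂ)
    (hrow : ∀ p, (∀ a, headLast m ρ a ≠ p) →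
      (scaled ρ C E 0 *ᵥ y) p = μ * (weight k m s ρ 0 *ᵥ y) p)
    (l : Blk (ρ : ℕ)) (a : Fin (s ρ)) :
    y (Sum.inl ⟨ρ, (l, a)⟩) = μ ^ ((l : ℕ) - 1) * y (headFirst m ρ a) := by
  obtain ⟨l, hl⟩ := l
  have hl' := Finset.mem_Icc.1 hl
  induction l with
  | zero => omega
  | succ l ih =>
    rcases Nat.eq_zero_or_pos l with rfl | h0
    · simp [headFirst, first]
    · have hm : l ∈ Finset.Icc 1 (ρ : ℕ) := Finset.mem_Icc.2 ⟨h0, by omega⟩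
      have h1 := hrow (Sum.inl ⟨ρ, (⟨l, hm⟩, a)⟩) (fun a' h' => by
        have := congrArg Subtype.val (Prod.mk.inj (eq_of_heq (Sigma.mk.inj (Sum.inl.inj h')).2)).1
        simp only [last] at this
        omega)
      rw [head_row_succ ⟨l, hm⟩ ⟨l + 1, hl⟩ rfl, weight_head, ih hm (Finset.mem_Icc.1 hm)] at h1
      rw [h1, ← mul_assoc, ← pow_succ']
      congr 2
      simp only
      omega

/-- The limit of the rescaled eigenvectors. -/
theorem exists_limit {μ γ : ℂ} (hμ0 : μ ≠ 0) (hμ : μ ^ (ρ : ℕ) = γ)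
    (hW : IsUnit (tailW E (ρ + 1))) (hC : IsUnit C)
    (φ : Fin (s ρ) → ℂ) (hφ : headS E ρ *ᵥ φ = γ • φ) :
    ∃ y : JIdx k s ⊕ Fin m → ℂ,
      scaled ρ C E 0 *ᵥ y = μ • (weight k m s ρ 0 *ᵥ y) ∧
      (∀ c, y (firstIdx m (ρ + 1) c) = (tailG E ρ *ᵥ φ) c) ∧
      ∀ l a, y (Sum.inl ⟨ρ, (l, a)⟩) = μ ^ ((l : ℕ) - 1) * φ a := by
  obtain ⟨y, hrow, hy⟩ := exists_rows hμ0 hW hC φ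
  have hyφ : (fun a => y (headFirst m ρ a)) = φ := funext hy
  have hchain : ∀ l a, y (Sum.inl ⟨ρ, (l, a)⟩) = μ ^ ((l : ℕ) - 1) * φ a := fun l a => by
    rw [chain_eq y hrow, hy]
  have htail : (fun c => y (firstIdx m (ρ + 1) c)) = tailG E ρ *ᵥ φ := by
    rw [← hyφ]
    refine tail_eq_tailG E ρ C y hW fun c => ?_
    rw [hrow, weight_lastIdx, mul_zero]
    intro a h
    have h1 : (ρ : ℕ) = (c.1.1 : ℕ) := congrArg (fun x : JIdx k s => (x.1 : ℕ)) (Sum.inl.inj h)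
    have := c.1.2
    omega
  refine ⟨y, ?_, fun c => congrFun htail c, hchain⟩
  ext p
  by_cases hp : ∃ a, headLast m ρ a = p
  · obtain ⟨a, rfl⟩ := hp
    rw [scaled_zero_headLast E ρ C y (by rw [htail, hyφ]), hyφ, hφ, Pi.smul_apply, Pi.smul_apply,
      headLast, weight_head, hchain, ← hμ, smul_eq_mul, smul_eq_mul, ← mul_assoc, ← pow_succ']
    have := Finset.mem_Icc.1 ρ.2
    congr 2
    simp only [last]
    omega
  · exact hrow p (by simpa using hp)

/-- The limit eigenpair of the rescaled problem is simple. -/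
theorem limit_simple {μ γ : ℂ} (hμ0 : μ ≠ 0) (hμ : μ ^ (ρ : ℕ) = γ)
    (hW : IsUnit (tailW E (ρ + 1))) (hC : IsUnit C)
    (hγ : (headS E ρ).charpoly.rootMultiplicity γ = 1)
    (φ : Fin (s ρ) → ℂ) (hφ : headS E ρ *ᵥ φ = γ • φ) (a₀ : Fin (s ρ)) (ha₀ : φ a₀ ≠ 0)
    (y : JIdx k s ⊕ Fin m → ℂ)
    (hy : ∀ l a, y (Sum.inl ⟨ρ, (l, a)⟩) = μ ^ ((l : ℕ) - 1) * φ a)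
    (δ : ℂ)
    (hu : scaled ρ C E 0 *ᵥ u - μ • (weight k m s ρ 0 *ᵥ u) = δ • (weight k m s ρ 0 *ᵥ y))
    (hu0 : u (headFirst m ρ a₀) = 0) : δ = 0 ∧ u = 0 := by
  have hρ := Finset.mem_Icc.1 ρ.2
  have hrow : ∀ p, (scaled ρ C E 0 *ᵥ u) p =
      μ * (weight k m s ρ 0 *ᵥ u) p + δ * (weight k m s ρ 0 *ᵥ y) p := by
    intro p
    have := congrFun hu p
    simp only [Pi.sub_apply, Pi.smul_apply, smul_eq_mul] at this
    linear_combination this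
  have htail := tail_eq_tailG E ρ C u hW fun c => by
    rw [hrow, weight_lastIdx, weight_lastIdx, mul_zero, mul_zero, add_zero]
  -- The inhomogeneous term is `δ` times the derivative of `μ ^ (l - 1)` in `μ`; the extra factor
  -- `μ` on both sides avoids the exponent `l - 2`.
  have hchain : ∀ (l : ℕ) (hl : l ∈ Finset.Icc 1 (ρ : ℕ)) (a : Fin (s ρ)),
      μ * u (Sum.inl ⟨ρ, (⟨l, hl⟩, a)⟩) = μ ^ l * u (headFirst m ρ a) +
        ((l : ℂ) - 1) * δ * μ ^ (l - 1) * φ a := by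
    intro l hl a
    have hl' := Finset.mem_Icc.1 hl
    induction l with
    | zero => omega
    | succ l ih =>
      rcases Nat.eq_zero_or_pos l with rfl | h0
      · simp [headFirst, first]
      · have hm : l ∈ Finset.Icc 1 (ρ : ℕ) := Finset.mem_Icc.2 ⟨h0, by omega⟩
        have h1 := hrow (Sum.inl ⟨ρ, (⟨l, hm⟩, a)⟩)
        rw [head_row_succ ⟨l, hm⟩ ⟨l + 1, hl⟩ rfl, weight_head, weight_head,
          ih hm (Finset.mem_Icc.1 hm), hy] at h1
        rw [h1]
        obtain ⟨d, rfl⟩ : ∃ d, l = d + 1 := ⟨l - 1, by omega⟩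
        simp only [Nat.add_sub_cancel]
        push_cast
        ring
  -- The last row closes the chain; the right side is `δ` times the derivative of `μ ^ ρ`, applied
  -- to `φ`.
  have hS : headS E ρ *ᵥ (fun a => u (headFirst m ρ a)) - γ • (fun a => u (headFirst m ρ a)) =
      ((ρ : ℕ) * δ * μ ^ ((ρ : ℕ) - 1)) • φ := by
    ext a
    have h1 := hrow (headLast m ρ a)
    rw [scaled_zero_headLast E ρ C u htail, headLast, weight_head, weight_head, hy] at h1
    have h2 := hchain ρ (last ρ).2 a
    simp only [Pi.sub_apply, Pi.smul_apply, smul_eq_mul]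
    rw [h1, ← hμ]
    change μ * u (Sum.inl ⟨ρ, (last ρ, a)⟩) = _ at h2
    rw [h2]
    simp only [last]
    ring
  have hφ0 : φ ≠ 0 := fun h => ha₀ (by rw [h]; rfl)
  obtain ⟨hc, α, hα⟩ := eq_zero_and_exists_smul_of_rootMultiplicity_eq_one _ γ hγ φ hφ0 hφ _ _ hS
  have hδ : δ = 0 := by
    have h3 : ((ρ : ℕ) : ℂ) ≠ 0 := Nat.cast_ne_zero.2 (by omega)
    have h4 := (mul_eq_zero.1 hc).resolve_right (pow_ne_zero _ hμ0)
    exact (mul_eq_zero.1 h4).resolve_left h3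
  refine ⟨hδ, ?_⟩
  have hα0 : α = 0 := by
    have := congrFun hα a₀
    simp only [Pi.smul_apply, smul_eq_mul, hu0] at this
    exact (mul_eq_zero.1 this.symm).resolve_right ha₀
  refine eq_zero_of_rows hμ0 hW hC (fun p _ => ?_) fun a => ?_
  · rw [hrow, hδ, zero_mul, add_zero]
  · have := congrFun hα a
    simpa [hα0] using this

/-- The branch of rescaled eigenvectors. -/
theorem exists_branch {μ γ : ℂ} (hμ : μ ^ (ρ : ℕ) = γ)
    (hWρ : IsUnit (tailW E ρ)) (hW : IsUnit (tailW E (ρ + 1))) (hC : IsUnit C)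
    (hγ : (headS E ρ).charpoly.rootMultiplicity γ = 1)
    (φ : Fin (s ρ) → ℂ) (hφ0 : φ ≠ 0) (hφ : headS E ρ *ᵥ φ = γ • φ) :
    ∃ (c : ℂ → ℂ) (y : ℂ → JIdx k s ⊕ Fin m → ℂ) (y₀ : JIdx k s ⊕ Fin m → ℂ),
      ((fun τ => c τ - μ) =O[𝓝 0] fun τ => τ) ∧
      (∀ q, (fun τ => y τ q - y₀ q) =O[𝓝 0] fun τ => τ) ∧
      (∀ᶠ τ in 𝓝 0, (shifted s C + τ ^ (ρ : ℕ) • E) *ᵥ (fun q => τ ^ expo ρ q * y τ q) =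
        (τ * c τ) • (fun q => τ ^ expo ρ q * y τ q) ∧
        (fun q => τ ^ expo ρ q * y τ q) ≠ 0) ∧
      (∀ c, y₀ (firstIdx m ρ c) = stack ρ φ (tailG E ρ *ᵥ φ) c) ∧
      ∀ l a, y₀ (Sum.inl ⟨ρ, (l, a)⟩) = μ ^ ((l : ℕ) - 1) * φ a := by
  have hρ := Finset.mem_Icc.1 ρ.2
  have hμ0 : μ ≠ 0 := by
    rintro rfl
    refine headS_eigenvalue_ne_zero E ρ hWρ hW φ hφ0 γ hφ ?_
    rw [← hμ, zero_pow (by omega)]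
  obtain ⟨a₀, ha₀⟩ := Function.ne_iff.1 hφ0
  obtain ⟨y₀, h0, htail, hchain⟩ := exists_limit hμ0 hμ hW hC φ hφ
  obtain ⟨c, y, hc, hy, hev⟩ := exists_eigenpair_branch (scaled ρ C E) (weight k m s ρ)
    (fun p q => by simp only [scaled, of_apply]; fun_prop)
    (fun p q => by
      by_cases h : p = q
      · subst h
        simp only [weight, diagonal_apply_eq]
        fun_prop
      · simp only [weight, diagonal_apply_ne _ h]
        fun_prop)
    μ y₀ (headFirst m ρ a₀) h0
    (fun δ u => limit_simple hμ0 hμ hW hC hγ φ hφ a₀ ha₀ y₀ hchain δ)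
  have hhead : ∀ a, y₀ (headFirst m ρ a) = φ a := fun a => by
    have := hchain (first ρ) a
    rwa [show ((first ρ : Blk (ρ : ℕ)) : ℕ) - 1 = 0 from rfl, pow_zero, one_mul] at this
  refine ⟨c, y, y₀, hc, hy, ?_, fun c => ?_, hchain⟩
  · filter_upwards [hev] with τ hτ
    refine ⟨unscale ρ C E τ _ _ hτ.1, fun h => ?_⟩
    -- The normalised coordinate has exponent zero, so it keeps the nonzero value `φ a₀` for every
    -- `τ`.
    have h1 := congrFun h (headFirst m ρ a₀)
    simp only [hτ.2, hhead] at h1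
    have h2 : expo ρ (headFirst m ρ a₀) = 0 := expo_firstIdx ρ (tailHead ρ a₀)
    rw [h2, pow_zero, one_mul] at h1
    exact ha₀ h1
  · rcases tail_cases ρ c with ⟨a, rfl⟩ | ⟨c', rfl⟩
    · rw [stack_tailHead]
      exact hhead a
    · rw [stack_tailTail]
      exact htail c'

end Reduced

end Indices

/-! ### Return to the original coordinates and to `t`. -/

section Transfer

variable {n m k : ℕ} {s : ℕ → ℕ}

section Coordinates

variable (Xi Sg : Matrix (Fin n) (JIdx k s) ℂ) (Xic Sgc : Matrix (Fin n) (Fin m) ℂ)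
  (D : Matrix (Fin n) (Fin n) ℂ)

theorem W_eq_tailW (i : ℕ) :
    W Xi Sg D i = tailW ((fromCols Sg Sgc)ᴴ * D * fromCols Xi Xic) i := rfl

theorem G_eq_tailG (ρ : Blk k) :
    G Xi Sg D ρ = tailG ((fromCols Sg Sgc)ᴴ * D * fromCols Xi Xic) ρ := by
  rw [G, tailG, W_eq_tailW Xi Sg Xic Sgc]
  rfl

theorem S_eq_headS (ρ : Blk k) :
    S Xi Sg D ρ = headS ((fromCols Sg Sgc)ᴴ * D * fromCols Xi Xic) ρ := by
  rw [S, headS, G_eq_tailG Xi Sg Xic Sgc]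
  rfl

theorem sum_colBlock_mulVec (x : JIdx k s → ℂ) :
    ∑ i, colBlock Xi i *ᵥ (fun p => x ⟨i, p⟩) = Xi *ᵥ x := by
  ext r
  simp only [Finset.sum_apply, mulVec, dotProduct, colBlock, submatrix_apply, id]
  rw [Fintype.sum_sigma (fun q : JIdx k s => Xi r q * x q)]

theorem tailFirst_mulVec (ρ : Blk k) (x : JIdx k s → ℂ) (v : Tail k s ρ → ℂ)
    (hv : ∀ c : Tail k s ρ, x ⟨c.1.1, (first c.1.1, c.2)⟩ = v c)
    (hx : ∀ q, (∀ c : Tail k s ρ, q ≠ ⟨c.1.1, (first c.1.1, c.2)⟩) → x q = 0) :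
    tailFirst Xi ρ *ᵥ v = Xi *ᵥ x := by
  ext r
  -- The complementary block plays no role here, so it is taken empty.
  have hi : Function.Injective
      fun c : Tail k s ρ => (⟨c.1.1, (first c.1.1, c.2)⟩ : JIdx k s) :=
    fun c c' h => firstIdx_injective (m := 0) ρ (congrArg Sum.inl h)
  refine Fintype.sum_of_injective _ hi _ _ (fun q hq => ?_) fun c => ?_
  · rw [hx q fun c hc => hq ⟨c, hc.symm⟩, mul_zero]
  · rw [hv]
    rfl

/-- Similarity by `P = [Ξ, Ξ_c]`: the left inverse keeps the vector nonzero, and the right inverse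
turns `P (Q D P)` into `D P`. -/
theorem hasEigenvector_of_coordinates {A : Matrix (Fin n) (Fin n) ℂ} {lam0 : ℂ}
    (hinv : (fromCols Sg Sgc)ᴴ * fromCols Xi Xic = 1)
    (hinv' : fromCols Xi Xic * (fromCols Sg Sgc)ᴴ = 1) (A22 : Matrix (Fin m) (Fin m) ℂ)
    (hA : A * fromCols Xi Xic = fromCols Xi Xic *
        fromBlocks (lam0 • (1 : Matrix (JIdx k s) (JIdx k s) ℂ) + nil k s) 0 0 A22)
    (ε ν : ℂ) (x : JIdx k s ⊕ Fin m → ℂ) (hx0 : x ≠ 0)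
    (hx : (shifted s (A22 - lam0 • 1) + ε • ((fromCols Sg Sgc)ᴴ * D * fromCols Xi Xic)) *ᵥ x =
      ν • x) :
    Module.End.HasEigenvector (toLin' (A + ε • D)) (lam0 + ν) (fromCols Xi Xic *ᵥ x) := by
  set P := fromCols Xi Xic
  set Q := (fromCols Sg Sgc)ᴴ
  have hJ : fromBlocks (lam0 • (1 : Matrix (JIdx k s) (JIdx k s) ℂ) + nil k s) 0 0 A22 =
      lam0 • 1 + shifted s (A22 - lam0 • 1) := by
    rw [shifted, ← fromBlocks_one, fromBlocks_smul, fromBlocks_add]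
    simp
  have hAD : (A + ε • D) * P = P * (lam0 • 1 + (shifted s (A22 - lam0 • 1) + ε • (Q * D * P))) := by
    have h1 : P * (Q * D * P) = D * P := by
      rw [Matrix.mul_assoc, ← Matrix.mul_assoc, hinv', Matrix.one_mul]
    rw [Matrix.add_mul, hA, hJ, ← add_assoc, Matrix.mul_add P _ (ε • _), Matrix.mul_smul, h1,
      Matrix.smul_mul]
  refine ⟨Module.End.mem_eigenspace_iff.2 ?_, fun h => hx0 ?_⟩
  · rw [toLin'_apply, mulVec_mulVec, hAD, ← mulVec_mulVec, add_mulVec, hx, smul_mulVec,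
      one_mulVec, ← add_smul, mulVec_smul]
  · rw [← one_mulVec x, ← hinv, ← mulVec_mulVec, h, mulVec_zero]

end Coordinates

theorem isUnit_sub_smul_one {A22 : Matrix (Fin m) (Fin m) ℂ} {lam0 : ℂ}
    (h : lam0 ∉ spectrum ℂ A22) : IsUnit (A22 - lam0 • (1 : Matrix (Fin m) (Fin m) ℂ)) := by
  rw [spectrum.notMem_iff] at h
  rw [← IsUnit.neg_iff, neg_sub]
  rwa [Algebra.algebraMap_eq_smul_one] at h

theorem tendsto_root {ρ : ℕ} (hρ : 1 ≤ ρ) :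
    Tendsto (fun t : ℝ => ((t ^ (1 / (ρ : ℝ)) : ℝ) : ℂ)) (𝓝[>] 0) (𝓝 0) := by
  have hpos : (0 : ℝ) < 1 / (ρ : ℝ) := by positivity
  have h1 : Tendsto (fun t : ℝ => t ^ (1 / (ρ : ℝ))) (𝓝 0) (𝓝 (0 ^ (1 / (ρ : ℝ)))) :=
    (Real.continuousAt_rpow_const 0 _ (Or.inr hpos.le)).tendsto
  rw [Real.zero_rpow hpos.ne'] at h1
  have h2 := (Complex.continuous_ofReal.tendsto 0).comp
    (h1.mono_left (nhdsWithin_le_nhds (s := Set.Ioi 0)))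
  rwa [Complex.ofReal_zero] at h2

theorem root_pow {ρ : ℕ} (t : ℝ) (ht : 0 < t) (e : ℕ) :
    (t ^ (1 / (ρ : ℝ))) ^ e = t ^ ((e : ℝ) / (ρ : ℝ)) := by
  rw [← Real.rpow_natCast, ← Real.rpow_mul ht.le]
  congr 1
  ring

theorem isBigO_root_pow (ρ e : ℕ) :
    (fun t : ℝ => ((t ^ (1 / (ρ : ℝ)) : ℝ) : ℂ) ^ e) =O[𝓝[>] 0]
      fun t : ℝ => t ^ ((e : ℝ) / (ρ : ℝ)) := by
  refine IsBigO.of_norm_eventuallyLE ?_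
  filter_upwards [self_mem_nhdsWithin] with t ht
  have ht : 0 < t := ht
  rw [norm_pow, Complex.norm_real, Real.norm_of_nonneg (by positivity), root_pow t ht]

end Transfer

end JordanPert

/-! ### Assembly of the expansions. -/

open JordanPert in
theorem corollary3p3
    (n m k : ℕ) (s : ℕ → ℕ) (hs : 0 < s k)
    (A D : Matrix (Fin n) (Fin n) ℂ) (lam0 : ℂ)
    -- `[Ξ, Ξ_c]` is invertible and `[Σ, Σ_c]` is its inverse conjugate transpose
    (Xi Sg : Matrix (Fin n) (JordanPert.JIdx k s) ℂ) (Xic Sgc : Matrix (Fin n) (Fin m) ℂ)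
    (hinv : (Matrix.fromCols Sg Sgc)ᴴ * Matrix.fromCols Xi Xic = 1)
    (hinv' : Matrix.fromCols Xi Xic * (Matrix.fromCols Sg Sgc)ᴴ = 1)
    -- `A [Ξ, Ξ_c] = [Ξ, Ξ_c] diag (λ₀ I + N, A₂₂)` with `λ₀` not an eigenvalue of `A₂₂`
    (A22 : Matrix (Fin m) (Fin m) ℂ)
    (hA : A * Matrix.fromCols Xi Xic =
      Matrix.fromCols Xi Xic *
        Matrix.fromBlocks (lam0 • (1 : Matrix (JordanPert.JIdx k s) (JordanPert.JIdx k s) ℂ)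
          + JordanPert.nil k s) 0 0 A22)
    (hA22 : lam0 ∉ spectrum ℂ A22)
    (ρ : JordanPert.Blk k)
    (hW : ∀ i : ℕ, 1 ≤ i → i ≤ (ρ : ℕ) → IsUnit (JordanPert.W Xi Sg D i))
    (hW' : (ρ : ℕ) < k → IsUnit (JordanPert.W Xi Sg D ((ρ : ℕ) + 1)))
    (γ : ℂ) (hγ : (JordanPert.S Xi Sg D ρ).charpoly.rootMultiplicity γ = 1)
    (φ : Fin (s ρ) → ℂ) (hφ0 : φ ≠ 0) (hφ : JordanPert.S Xi Sg D ρ *ᵥ φ = γ • φ)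
    (μ : ℂ) (hμ : μ ^ (ρ : ℕ) = γ) :
    ∃ (lam : ℝ → ℂ) (h : ℝ → Fin n → ℂ)
      (hb : (i : JordanPert.Blk k) → ℝ → JordanPert.BIdx s (i : ℕ) → ℂ),
      (∀ᶠ t : ℝ in 𝓝[>] 0,
        Module.End.HasEigenvector (Matrix.toLin' (A + (t : ℂ) • D)) (lam t) (h t)) ∧
      ((fun t : ℝ => lam t - (lam0 + ((t ^ (1 / ((ρ : ℕ) : ℝ)) : ℝ) : ℂ) * μ))
        =O[𝓝[>] 0] fun t : ℝ => t ^ (2 / ((ρ : ℕ) : ℝ))) ∧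
      ((fun t : ℝ => h t -
          (JordanPert.tailFirst Xi (ρ : ℕ) *ᵥ
              JordanPert.stack ρ φ (JordanPert.G Xi Sg D ρ *ᵥ φ)
            + ∑ i : JordanPert.Blk k, JordanPert.colBlock Xi i *ᵥ hb i t))
        =O[𝓝[>] 0] fun t : ℝ => t) ∧
      (∀ l : JordanPert.Blk (ρ : ℕ),
        (fun (t : ℝ) (a : Fin (s ρ)) => hb ρ t (l, a) -
            JordanPert.lead (ρ : ℕ) φ (((t ^ (1 / ((ρ : ℕ) : ℝ)) : ℝ) : ℂ) * μ) l a)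
          =O[𝓝[>] 0] fun t : ℝ =>
            t ^ ((JordanPert.order (ρ : ℕ) (ρ : ℕ) (l : ℕ) : ℝ) / ((ρ : ℕ) : ℝ))) ∧
      (∀ i : JordanPert.Blk k, i ≠ ρ → ∀ l : JordanPert.Blk (i : ℕ),
        (fun (t : ℝ) (a : Fin (s i)) => hb i t (l, a))
          =O[𝓝[>] 0] fun t : ℝ =>
            t ^ ((JordanPert.order (ρ : ℕ) (i : ℕ) (l : ℕ) : ℝ) / ((ρ : ℕ) : ℝ))) := by
  have hρ := Finset.mem_Icc.1 ρ.2
  have hW1 : IsUnit (W Xi Sg D ((ρ : ℕ) + 1)) := by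
    by_cases hk : (ρ : ℕ) < k
    · exact hW' hk
    -- For `ρ = k` there are no longer chains, and the void matrix `W_{k+1}` is invertible.
    · have : IsEmpty (Tail k s ((ρ : ℕ) + 1)) := ⟨fun c => by
        have h1 := c.1.2
        have h2 := Finset.mem_Icc.1 c.1.1.2
        omega⟩
      rw [show W Xi Sg D ((ρ : ℕ) + 1) = 1 from Subsingleton.elim _ _]
      exact isUnit_one
  have hWρ := hW ρ hρ.1 le_rfl
  rw [W_eq_tailW Xi Sg Xic Sgc] at hWρ hW1
  rw [S_eq_headS Xi Sg Xic Sgc] at hγ hφ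
  have hC := isUnit_sub_smul_one hA22
  rw [G_eq_tailG Xi Sg Xic Sgc]
  obtain ⟨c, y, y₀, hc, hy, hev, hstack, hchain⟩ :=
    exists_branch hμ hWρ hW1 hC hγ φ hφ0 hφ
  set E := (fromCols Sg Sgc)ᴴ * D * fromCols Xi Xic
  set τ : ℝ → ℂ := fun t => ((t ^ (1 / ((ρ : ℕ) : ℝ)) : ℝ) : ℂ) with hτ
  have hτ0 : Tendsto τ (𝓝[>] 0) (𝓝 0) := tendsto_root hρ.1
  have hτO : ∀ e : ℕ, (fun t => τ t ^ e) =O[𝓝[>] 0] fun t : ℝ => t ^ ((e : ℝ) / ((ρ : ℕ) : ℝ)) :=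
    isBigO_root_pow ρ
  have hτρ : ∀ t : ℝ, 0 < t → τ t ^ (ρ : ℕ) = t := fun t ht => by
    have h1 : ((ρ : ℕ) : ℝ) ≠ 0 := Nat.cast_ne_zero.2 (by omega)
    rw [hτ]
    simp only
    rw [← Complex.ofReal_pow, root_pow t ht, div_self h1, Real.rpow_one]
  have hcτ : (fun t => c (τ t) - μ) =O[𝓝[>] 0] τ := hc.comp_tendsto hτ0
  have hyτ : ∀ q, (fun t => y (τ t) q - y₀ q) =O[𝓝[>] 0] τ := fun q => (hy q).comp_tendsto hτ0
  have hy1 : ∀ q, (fun t => y (τ t) q) =O[𝓝[>] 0] fun _ => (1 : ℂ) := fun q => by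
    have h1 := ((hyτ q).trans (hτ0.isBigO_one ℂ)).add (isBigO_const_const (y₀ q) one_ne_zero _)
    simpa using h1
  set x : ℝ → JIdx k s ⊕ Fin m → ℂ := fun t q => τ t ^ expo ρ q * y (τ t) q with hx
  have hxO : ∀ q, (fun t => x t q) =O[𝓝[>] 0]
      fun t : ℝ => t ^ ((expo ρ q : ℝ) / ((ρ : ℕ) : ℝ)) := fun q => by
    have h1 := (hτO (expo ρ q)).mul ((hy1 q).trans (isBigO_const_const (1 : ℂ) (one_ne_zero (α := ℝ))
      (𝓝[>] 0)))
    simpa using h1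
  -- The value of `x` at `τ = 0`: since `0 ^ 0 = 1`, only leading vectors of chains of length at
  -- least `ρ` survive, with coefficients `[φ; G_ρ φ]`. The `h_i` are the remainders `x - base`.
  set base : JIdx k s ⊕ Fin m → ℂ := fun q => 0 ^ expo ρ q * y₀ q with hbase
  have hxb : ∀ q, expo ρ q = 0 → (fun t => x t q - base q) =O[𝓝[>] 0]
      fun t : ℝ => t ^ (((1 : ℕ) : ℝ) / ((ρ : ℕ) : ℝ)) := fun q hq => by
    simp only [hx, hbase, hq, pow_zero, one_mul]
    simpa using (hyτ q).trans (by simpa using hτO 1)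
  have hxb' : ∀ q, expo ρ q ≠ 0 → base q = 0 := fun q hq => by
    simp only [hbase, zero_pow hq, zero_mul]
  refine ⟨fun t => lam0 + τ t * c (τ t), fun t => fromCols Xi Xic *ᵥ x t,
    fun i t p => x t (Sum.inl ⟨i, p⟩) - base (Sum.inl ⟨i, p⟩), ?_, ?_, ?_, ?_, ?_⟩
  · filter_upwards [hτ0.eventually hev, self_mem_nhdsWithin] with t ht htpos
    rw [hτρ t htpos] at ht
    exact hasEigenvector_of_coordinates Xi Sg Xic Sgc D hinv hinv' A22 hA _ _ _ ht.2 ht.1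
  · have h1 : (fun t => τ t * (c (τ t) - μ)) =O[𝓝[>] 0] fun t => τ t ^ 2 := by
      simpa only [pow_two] using (isBigO_refl τ (𝓝[>] 0)).mul hcτ
    have h2 := h1.trans (hτO 2)
    push_cast at h2
    refine h2.congr_left fun t => ?_
    ring
  · have h1 : tailFirst Xi ρ *ᵥ stack ρ φ (tailG E ρ *ᵥ φ) = Xi *ᵥ fun q => base (Sum.inl q) := by
      refine tailFirst_mulVec Xi ρ _ _ (fun c => ?_) fun q hq => hxb' _ fun h0 => ?_
      · rw [← hstack]
        change 0 ^ expo ρ (firstIdx m ρ c) * y₀ (firstIdx m ρ c) = _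
        rw [expo_firstIdx, pow_zero, one_mul]
      · obtain ⟨c, h2⟩ := exists_eq_firstIdx_of_expo_eq_zero ρ _ h0
        exact hq c (Sum.inl.inj h2)
    -- What the `h_i` do not absorb is the `Ξ_c` component, whose weight is `τ ^ ρ = t`.
    have h2 : ∀ t, fromCols Xi Xic *ᵥ x t - (tailFirst Xi ρ *ᵥ stack ρ φ (tailG E ρ *ᵥ φ) +
        ∑ i, colBlock Xi i *ᵥ fun p => x t (Sum.inl ⟨i, p⟩) - base (Sum.inl ⟨i, p⟩)) =
        Xic *ᵥ fun j => x t (Sum.inr j) := fun t => by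
      rw [h1, sum_colBlock_mulVec Xi fun q => x t (Sum.inl q) - base (Sum.inl q), ← mulVec_add,
        fromCols_mulVec, sub_eq_iff_eq_add']
      congr 2
      ext q
      simp
    simp only [h2]
    refine isBigO_pi.2 fun r => ?_
    simp only [mulVec, dotProduct]
    refine IsBigO.fun_sum fun j _ => IsBigO.const_mul_left ?_ _
    refine (hxO (Sum.inr j)).congr' EventuallyEq.rfl ?_
    filter_upwards with t
    have h3 : ((ρ : ℕ) : ℝ) ≠ 0 := Nat.cast_ne_zero.2 (by omega)
    change t ^ (((ρ : ℕ) : ℝ) / ((ρ : ℕ) : ℝ)) = t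
    rw [div_self h3, Real.rpow_one]
  · intro l
    have hl := Finset.mem_Icc.1 l.2
    refine isBigO_pi.2 fun a => ?_
    have he : expo (m := m) ρ (Sum.inl ⟨ρ, (l, a)⟩) = (l : ℕ) - 1 := expo_rho l a
    have ho : order (ρ : ℕ) ρ l = l := by simp [order]
    rw [ho]
    by_cases h1 : (l : ℕ) = 1
    · have := hxb (Sum.inl ⟨ρ, (l, a)⟩) (by rw [he]; omega)
      rw [h1]
      simpa only [lead, if_pos h1, Pi.zero_apply, sub_zero] using this
    -- Subtracting the explicit term replaces `y` by `y - y₀`, which gains one power of `τ` over the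
    -- weight `l - 1`.
    · have h2 : (fun t => τ t ^ ((l : ℕ) - 1) *
          (y (τ t) (Sum.inl ⟨ρ, (l, a)⟩) - y₀ (Sum.inl ⟨ρ, (l, a)⟩))) =O[𝓝[>] 0]
          fun t => τ t ^ (l : ℕ) := by
        have h3 := (isBigO_refl (fun t => τ t ^ ((l : ℕ) - 1)) (𝓝[>] 0)).mul
          (hyτ (Sum.inl ⟨ρ, (l, a)⟩))
        simpa only [← pow_succ, Nat.sub_add_cancel hl.1] using h3
      refine (h2.trans (hτO l)).congr_left fun t => ?_
      beta_reduce
      rw [hxb' _ (by rw [he]; omega), hchain, lead, if_neg h1]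
      simp only [hx, he, Pi.smul_apply, smul_eq_mul, mul_pow]
      ring
  · intro i hi l
    have hl := Finset.mem_Icc.1 l.2
    have hi' : (i : ℕ) ≠ ρ := fun h => hi (Subtype.ext h)
    refine isBigO_pi.2 fun a => ?_
    -- Exponent zero means the first block of a longer chain; there subtracting `base` gains the
    -- order `1`. Elsewhere `base` vanishes and `order` equals `expo`.
    by_cases h0 : expo (m := m) ρ (Sum.inl ⟨i, (l, a)⟩) = 0
    · have ho : order (ρ : ℕ) i l = 1 := by
        rw [expo_inl] at h0
        rw [order]
        split_ifs at h0 ⊢ <;> omega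
      rw [ho]
      exact hxb _ h0
    · have ho : order (ρ : ℕ) i l = expo (m := m) ρ (Sum.inl ⟨i, (l, a)⟩) := by
        rw [expo_inl] at h0 ⊢
        rw [order]
        split_ifs at h0 ⊢ <;> omega
      rw [ho]
      simp only [hxb' _ h0, sub_zero]
      exact hxO _
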